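/- There exist universal constants $C>0$ and $c>0$ such that the following holds. Let $\mathbb{K}$ be $\mathbb{R}$ or $\mathbb{C}$, and let $A\in\mathbb{K}^{m\times n}$ be a nonzero matrix of rank $k$ and stable rank $r=\|A\|_F^2/\|A\|_2^2$. Let $\kappa(A)=\sigma_1(A)/\sigma_k(A)$ be the ratio of the largest to the smallest nonzero singular value of $A$. Let $\delta\in(0,1)$ and $0<\varepsilon<\kappa(A)^{-1}$, and let $d_1\in\{1,\dots,m\}$ and $d_2\in\{1,\dots,n\}$ satisfy \[ d_1,\,d_2\ \ge\ C\,\frac{r}{\varepsilon^4\delta}\log\left(\frac{r}{\varepsilon^4\delta}\right). \] Choose $d_1$ row indices $I$ with replacement, where row $i$ is drawn with probability $\|A(i,:)\|_2^2/\|A\|_F^2$, and $d_2$ column indices $J$ with replacement, where column $j$ is drawn with probability $\|A(:,j)\|_2^2/\|A\|_F^2$, all $d_1+d_2$ draws being independent. Set $C_J=A(:,J)$, $U=A(I,J)$ and $R=A(I,:)$, and let $U^\dagger$ denote the Moore--Penrose pseudoinverse of $U$. Then, with probability at least $\left(1-2e^{-c/\delta}\right)^2$, \[ \operatorname{rank}(U)=k\quad\text{and}\quad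 A=C_J\,U^\dagger R. \] Moreover, the same conclusion holds, with the same probability bound, if $I$ and $J$ are replaced by the sets $I_0$ and $J_0$ of their distinct entries. -/

import Mathlib

namespace CURSampling

open scoped Matrix ComplexOrder

section PseudoInverse

variable {𝕂 : Type*} [RCLike 𝕂] {m n : Type*} [Fintype m] [Fintype n]

/-- The four Penrose equations: `X` is a Moore--Penrose pseudoinverse of `A`. -/
structure IsMoorePenrose (A : Matrix m n 𝕂) (X : Matrix n m 𝕂) : Prop where
  mul_mul_self : A * X * A = A
  self_mul_mul : X * A * X = X
  hermitian_left : (A * X)ᴴ = A * X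
  hermitian_right : (X * A)ᴴ = X * A

theorem IsMoorePenrose.unique {A : Matrix m n 𝕂} {X Y : Matrix n m 𝕂}
    (hX : IsMoorePenrose A X) (hY : IsMoorePenrose A Y) : X = Y := by
  have h1 : A * X = A * Y := by
    calc A * X = (A * X)ᴴ := hX.hermitian_left.symm
      _ = ((A * Y) * (A * X))ᴴ := by rw [← Matrix.mul_assoc, hY.mul_mul_self]
      _ = (A * X) * (A * Y) := by
          rw [Matrix.conjTranspose_mul, hX.hermitian_left, hY.hermitian_left]
      _ = A * Y := by rw [← Matrix.mul_assoc, hX.mul_mul_self]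
  have h2 : X * A = Y * A := by
    calc X * A = (X * A)ᴴ := hX.hermitian_right.symm
      _ = ((X * A) * (Y * A))ᴴ := by
          rw [Matrix.mul_assoc, ← Matrix.mul_assoc A, hY.mul_mul_self]
      _ = (Y * A) * (X * A) := by
          rw [Matrix.conjTranspose_mul, hX.hermitian_right, hY.hermitian_right]
      _ = Y * A := by rw [Matrix.mul_assoc, ← Matrix.mul_assoc A, hX.mul_mul_self]
  calc X = X * A * X := hX.self_mul_mul.symm
    _ = Y * A * Y := by rw [h2, Matrix.mul_assoc, h1, ← Matrix.mul_assoc]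
    _ = Y := hY.self_mul_mul

theorem exists_isMoorePenrose (A : Matrix m n 𝕂) : ∃ X, IsMoorePenrose A X := by
  classical
  have hH : (Aᴴ * A).IsHermitian := Matrix.isHermitian_conjTranspose_mul_self A
  obtain ⟨G, hGh, hc, h1, h2⟩ : ∃ G : Matrix n n 𝕂, Gᴴ = G ∧ G * (Aᴴ * A) = (Aᴴ * A) * G ∧
      (Aᴴ * A) * G * (Aᴴ * A) = Aᴴ * A ∧ G * (Aᴴ * A) * G = G := by
    set U : Matrix n n 𝕂 := (hH.eigenvectorUnitary : Matrix n n 𝕂) with hU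
    set e : n → ℝ := hH.eigenvalues with he
    set D : Matrix n n 𝕂 := Matrix.diagonal (fun i => (e i : 𝕂)) with hD
    set E : Matrix n n 𝕂 := Matrix.diagonal (fun i => ((e i)⁻¹ : 𝕂)) with hE
    have hUU : Uᴴ * U = 1 := by
      have := (Matrix.mem_unitaryGroup_iff' (A := U)).1 hH.eigenvectorUnitary.2
      simpa [Matrix.star_eq_conjTranspose] using this
    have hs : Aᴴ * A = U * D * Uᴴ := by
      have := hH.spectral_theorem
      rw [Unitary.conjStarAlgAut_apply] at this
      simpa [Matrix.star_eq_conjTranspose, Function.comp_def] using this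
    have key : ∀ P Q : Matrix n n 𝕂, (U * P * Uᴴ) * (U * Q * Uᴴ) = U * (P * Q) * Uᴴ := by
      intro P Q
      calc (U * P * Uᴴ) * (U * Q * Uᴴ) = U * P * (Uᴴ * U) * Q * Uᴴ := by
            simp only [Matrix.mul_assoc]
        _ = U * (P * Q) * Uᴴ := by rw [hUU]; simp only [Matrix.mul_assoc, Matrix.one_mul]
    refine ⟨U * E * Uᴴ, ?_, ?_, ?_, ?_⟩
    · rw [Matrix.conjTranspose_mul, Matrix.conjTranspose_mul, Matrix.conjTranspose_conjTranspose,
        hE, Matrix.diagonal_conjTranspose, Matrix.mul_assoc]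
      congr 3
      ext i
      simp
    · rw [hs, key, key]
      congr 2
      simp only [hD, hE, Matrix.diagonal_mul_diagonal, mul_comm]
    · rw [hs, key, key]
      congr 2
      simp only [hD, hE, Matrix.diagonal_mul_diagonal]
      congr 1
      ext i
      by_cases h : (e i : 𝕂) = 0 <;> simp [h]
    · rw [hs, key, key]
      congr 2
      simp only [hD, hE, Matrix.diagonal_mul_diagonal]
      congr 1
      ext i
      by_cases h : (e i : 𝕂) = 0 <;> simp [h]
  have h3 : A * (G * (Aᴴ * A)) = A := by
    rw [← sub_eq_zero, ← Matrix.conjTranspose_mul_self_eq_zero]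
    have : (A * (G * (Aᴴ * A)) - A)ᴴ = (Aᴴ * A) * G * Aᴴ - Aᴴ := by
      simp [Matrix.conjTranspose_mul, hGh]
    rw [this, Matrix.sub_mul, Matrix.mul_sub, Matrix.mul_sub]
    have e1 : Aᴴ * A * G * Aᴴ * (A * (G * (Aᴴ * A))) = Aᴴ * A := by
      calc _ = (Aᴴ * A * G * (Aᴴ * A)) * G * (Aᴴ * A) := by simp only [Matrix.mul_assoc]
        _ = _ := by rw [h1, h1]
    have e2 : Aᴴ * A * G * Aᴴ * A = Aᴴ * A := by
      rw [Matrix.mul_assoc _ Aᴴ A, h1]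
    have e3 : Aᴴ * (A * (G * (Aᴴ * A))) = Aᴴ * A := by
      rw [← Matrix.mul_assoc, ← Matrix.mul_assoc, h1]
    rw [e1, e2, e3, sub_self]
  refine ⟨G * Aᴴ, ?_, ?_, ?_, ?_⟩
  · rw [Matrix.mul_assoc, Matrix.mul_assoc, h3]
  · rw [Matrix.mul_assoc G, ← Matrix.mul_assoc (G * (Aᴴ * A)), h2]
  · simp [Matrix.conjTranspose_mul, hGh, Matrix.mul_assoc]
  · rw [Matrix.mul_assoc, Matrix.conjTranspose_mul, hGh, hH.eq, hc]

/-- The Moore--Penrose pseudoinverse `A†`. -/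
noncomputable def pinv (A : Matrix m n 𝕂) : Matrix n m 𝕂 :=
  Classical.choose (exists_isMoorePenrose A)

theorem isMoorePenrose_pinv (A : Matrix m n 𝕂) : IsMoorePenrose A (pinv A) :=
  Classical.choose_spec (exists_isMoorePenrose A)

end PseudoInverse

section Quantities

variable {𝕂 : Type*} [RCLike 𝕂] {m n : ℕ}

/-- The Euclidean length `‖A(i,:)‖₂` of the `i`-th row. -/
noncomputable def rowLength (A : Matrix (Fin m) (Fin n) 𝕂) (i : Fin m) : ℝ :=
  ‖(WithLp.toLp 2 (fun j => A i j) : EuclideanSpace 𝕂 (Fin n))‖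

/-- The Euclidean length `‖A(:,j)‖₂` of the `j`-th column. -/
noncomputable def colLength (A : Matrix (Fin m) (Fin n) 𝕂) (j : Fin n) : ℝ :=
  ‖(WithLp.toLp 2 (fun i => A i j) : EuclideanSpace 𝕂 (Fin m))‖

/-- The Frobenius norm `‖A‖_F`. -/
noncomputable def frobNorm (A : Matrix (Fin m) (Fin n) 𝕂) : ℝ :=
  Real.sqrt (∑ i, ∑ j, ‖A i j‖ ^ 2)

/-- The spectral norm `‖A‖₂`: the operator norm between Euclidean spaces. -/
noncomputable def specNorm (A : Matrix (Fin m) (Fin n) 𝕂) : ℝ :=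
  ‖(Matrix.toEuclideanLin A).toContinuousLinearMap‖

/-- The stable rank `‖A‖_F² / ‖A‖₂²`. -/
noncomputable def stableRank (A : Matrix (Fin m) (Fin n) 𝕂) : ℝ :=
  frobNorm A ^ 2 / specNorm A ^ 2

/-- The generalized condition number: largest singular value over smallest nonzero one.
Singular values are listed in decreasing order, starting from index `0`. -/
noncomputable def condNumber (A : Matrix (Fin m) (Fin n) 𝕂) : ℝ :=
  (Matrix.toEuclideanLin A).singularValues 0 /
    (Matrix.toEuclideanLin A).singularValues (A.rank - 1)

theorem frobNorm_sq (A : Matrix (Fin m) (Fin n) 𝕂) :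
    frobNorm A ^ 2 = ∑ i, ∑ j, ‖A i j‖ ^ 2 :=
  Real.sq_sqrt (by positivity)

theorem frobNorm_sq_pos {A : Matrix (Fin m) (Fin n) 𝕂} (hA : A ≠ 0) : 0 < frobNorm A ^ 2 := by
  rw [frobNorm_sq]
  obtain ⟨i, j, hij⟩ : ∃ i j, A i j ≠ 0 := by
    by_contra! h
    exact hA (Matrix.ext h)
  refine Finset.sum_pos' (fun _ _ => by positivity) ⟨i, Finset.mem_univ i, ?_⟩
  exact Finset.sum_pos' (fun _ _ => by positivity) ⟨j, Finset.mem_univ j, by positivity⟩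

theorem sum_rowLength_sq (A : Matrix (Fin m) (Fin n) 𝕂) :
    ∑ i, rowLength A i ^ 2 = frobNorm A ^ 2 := by
  simp [frobNorm_sq, rowLength, EuclideanSpace.norm_sq_eq]

theorem sum_colLength_sq (A : Matrix (Fin m) (Fin n) 𝕂) :
    ∑ j, colLength A j ^ 2 = frobNorm A ^ 2 := by
  rw [frobNorm_sq, Finset.sum_comm]
  simp [colLength, EuclideanSpace.norm_sq_eq]

theorem sum_ofReal_div {ι : Type*} [Fintype ι] (f : ι → ℝ) (s : ℝ)
    (hs : 0 < s) (h : ∑ i, f i ^ 2 = s) : ∑ i, ENNReal.ofReal (f i ^ 2 / s) = 1 := by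
  rw [← ENNReal.ofReal_sum_of_nonneg (fun i _ => by positivity), ← Finset.sum_div, h,
    div_self hs.ne', ENNReal.ofReal_one]

/-- Row length sampling: row `i` has probability `‖A(i,:)‖₂² / ‖A‖_F²`. -/
noncomputable def rowPMF (A : Matrix (Fin m) (Fin n) 𝕂) (hA : A ≠ 0) : PMF (Fin m) :=
  PMF.ofFintype (fun i => ENNReal.ofReal (rowLength A i ^ 2 / frobNorm A ^ 2))
    (sum_ofReal_div _ _ (frobNorm_sq_pos hA) (sum_rowLength_sq A))

/-- Column length sampling: column `j` has probability `‖A(:,j)‖₂² / ‖A‖_F²`. -/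
noncomputable def colPMF (A : Matrix (Fin m) (Fin n) 𝕂) (hA : A ≠ 0) : PMF (Fin n) :=
  PMF.ofFintype (fun j => ENNReal.ofReal (colLength A j ^ 2 / frobNorm A ^ 2))
    (sum_ofReal_div _ _ (frobNorm_sq_pos hA) (sum_colLength_sq A))

/-- The joint law of `(I, J)`: `d₁` row indices and `d₂` column indices, all drawn independently
(with replacement) from the row length and the column length distribution. -/
noncomputable def samplingLaw (A : Matrix (Fin m) (Fin n) 𝕂) (hA : A ≠ 0) (d₁ d₂ : ℕ) :
    MeasureTheory.Measure ((Fin d₁ → Fin m) × (Fin d₂ → Fin n)) :=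
  (MeasureTheory.Measure.pi fun _ => (rowPMF A hA).toMeasure).prod
    (MeasureTheory.Measure.pi fun _ => (colPMF A hA).toMeasure)

/-- The inclusion of the set of distinct values of a finite index family. -/
def dedup {d p : ℕ} (I : Fin d → Fin p) : {i // i ∈ Finset.univ.image I} → Fin p :=
  Subtype.val

end Quantities

end CURSampling

namespace CURSampling

open scoped Matrix ComplexOrder

/-! ### Singular value bounds and the weight of columns outside a subspace -/

section SingularValues

open Module

variable {𝕂 : Type*} [RCLike 𝕂]
  {E : Type*} [NormedAddCommGroup E] [InnerProductSpace 𝕂 E] [FiniteDimensional 𝕂 E]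
  {F : Type*} [NormedAddCommGroup F] [InnerProductSpace 𝕂 F] [FiniteDimensional 𝕂 F]

/-! Exactness of the CUR decomposition is deterministic once the sampled columns and the sampled
rows each have rank `k` (`rank_eq_and_eq_cur`), so only these two independent events need
estimating.

Let `s` be the smallest nonzero singular value and `V` the span of the columns drawn so far. The
columns outside `V` carry squared length at least `s ^ 2` times the codimension of `V` in the column
space (`singularValues_sq_mul_codim_le_sum`). With `p = s ^ 2 / ‖A‖_F ^ 2`, each draw thus
multiplies the expected codimension by at most `1 - p`, and Markov's inequality bounds the failure
probability by `(1 - p) ^ d * k` (`sum_prod_mul_codim_le`, `sum_prod_span_lt_le`).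

Put `x = r / (ε ^ 4 * δ)`. The condition on `ε` gives `1 ≤ δ * x * p`, hence `k ≤ x`. For `k ≥ 2`,
`d ≥ 3 * x * log x` then makes the failure probability at most `exp (-1 / δ)`; for `k = 1` it is
zero. Rows are handled by passing to `Aᴴ`. -/

theorem norm_map_sq_eq_sum_singularValues (T : E →ₗ[𝕂] F) (x : E) :
    ‖T x‖ ^ 2 = ∑ i : Fin (finrank 𝕂 E), T.singularValues i ^ 2 *
      ‖inner 𝕂 (T.isSymmetric_adjoint_comp_self.eigenvectorBasis rfl i) x‖ ^ 2 := by
  set hS := T.isSymmetric_adjoint_comp_self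
  set b := hS.eigenvectorBasis rfl
  have hb (i) : inner 𝕂 (b i) ((T.adjoint ∘ₗ T) x) =
      ((T.singularValues i ^ 2 : ℝ) : 𝕂) * inner 𝕂 (b i) x := by
    rw [← hS (b i) x, hS.apply_eigenvectorBasis, inner_smul_left, T.sq_singularValues_fin rfl]
    simp [b]
  have h1 : ((‖T x‖ ^ 2 : ℝ) : 𝕂) = inner 𝕂 x ((T.adjoint ∘ₗ T) x) := by
    rw [LinearMap.comp_apply, LinearMap.adjoint_inner_right, inner_self_eq_norm_sq_to_K]
    push_cast; rfl
  rw [← b.sum_inner_mul_inner] at h1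
  have h2 : ((‖T x‖ ^ 2 : ℝ) : 𝕂) = ((∑ i : Fin (finrank 𝕂 E), T.singularValues i ^ 2 *
      ‖inner 𝕂 (b i) x‖ ^ 2 : ℝ) : 𝕂) := by
    rw [h1, RCLike.ofReal_sum]
    refine Finset.sum_congr rfl fun i _ => ?_
    rw [hb, mul_left_comm, ← inner_conj_symm x (b i), RCLike.conj_mul]
    push_cast; rfl
  exact RCLike.ofReal_injective h2

theorem norm_map_le_singularValues_zero (T : E →ₗ[𝕂] F) (x : E) :
    ‖T x‖ ≤ T.singularValues 0 * ‖x‖ := by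
  refine le_of_sq_le_sq ?_ (mul_nonneg (T.singularValues_nonneg 0) (norm_nonneg x))
  rw [norm_map_sq_eq_sum_singularValues, mul_pow,
    ← (T.isSymmetric_adjoint_comp_self.eigenvectorBasis rfl).sum_sq_norm_inner_right x,
    Finset.mul_sum]
  gcongr with i
  · exact T.singularValues_nonneg i
  · exact T.singularValues_antitone (Nat.zero_le _)

theorem singularValues_mul_norm_le (T : E →ₗ[𝕂] F) {x : E} (hx : x ∈ T.kerᗮ) :
    T.singularValues (finrank 𝕂 T.range - 1) * ‖x‖ ≤ ‖T x‖ := by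
  refine le_of_sq_le_sq ?_ (norm_nonneg _)
  rw [norm_map_sq_eq_sum_singularValues, mul_pow,
    ← (T.isSymmetric_adjoint_comp_self.eigenvectorBasis rfl).sum_sq_norm_inner_right x,
    Finset.mul_sum]
  refine Finset.sum_le_sum fun i _ => ?_
  rcases lt_or_ge (i : ℕ) (finrank 𝕂 T.range) with hi | hi
  · gcongr
    · exact T.singularValues_nonneg _
    · exact T.singularValues_antitone (by omega)
  -- Eigenvectors with index beyond the rank lie in the kernel, so `x` has no component along them.
  · have h0 := T.singularValues_eq_zero_iff_le_finrank_range.2 hi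
    have hk : T.isSymmetric_adjoint_comp_self.eigenvectorBasis rfl i ∈ T.ker := by
      rw [← LinearMap.ker_adjoint_comp_self, LinearMap.mem_ker,
        LinearMap.IsSymmetric.apply_eigenvectorBasis, ← T.sq_singularValues_fin rfl, h0]
      simp
    rw [Submodule.inner_right_of_mem_orthogonal hk hx]
    simp

/-- Write `u = T x` with `x` orthogonal to the kernel. Cauchy–Schwarz gives `‖T x‖ ^ 2 ≤ ‖x‖ *
‖T.adjoint (T x)‖`, and the lower bound on `‖T x‖` lets one factor `‖x‖` cancel. -/
theorem singularValues_mul_norm_le_norm_adjoint (T : E →ₗ[𝕂] F) {u : F} (hu : u ∈ T.range) :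
    T.singularValues (finrank 𝕂 T.range - 1) * ‖u‖ ≤ ‖T.adjoint u‖ := by
  obtain ⟨y, rfl⟩ := hu
  obtain ⟨z, hz, x, hx, rfl⟩ := T.ker.exists_add_mem_mem_orthogonal y
  have hz : T z = 0 := hz
  rw [map_add, hz, zero_add]
  have h1 := singularValues_mul_norm_le T hx
  have h2 : ‖T x‖ * ‖T x‖ ≤ ‖x‖ * ‖T.adjoint (T x)‖ := by
    have := norm_inner_le_norm (𝕜 := 𝕂) x (T.adjoint (T x))
    rwa [LinearMap.adjoint_inner_right, inner_self_eq_norm_sq_to_K, norm_pow, RCLike.norm_ofReal,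
      abs_norm, sq] at this
  rcases (norm_nonneg x).eq_or_lt with h0 | h0
  · rw [norm_eq_zero.1 h0.symm]; simp
  · refine le_of_mul_le_mul_left ?_ h0
    nlinarith [norm_nonneg (T x)]

/-- Sum `‖T.adjoint b‖ ^ 2` over an orthonormal basis of the complement of `V` in the range.
Expanded along `e`, the vectors `T (e j)` in `V` contribute nothing, and Bessel's inequality bounds
the contribution of each other one by its squared norm. -/
theorem singularValues_sq_mul_codim_le_sum {ι : Type*} [Fintype ι] (e : OrthonormalBasis ι 𝕂 E)
    (T : E →ₗ[𝕂] F) {s : ℝ} (hs : 0 ≤ s) (h : ∀ u ∈ T.range, s * ‖u‖ ≤ ‖T.adjoint u‖)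
    {V : Submodule 𝕂 F} (hV : V ≤ T.range) [DecidablePred fun j => T (e j) ∉ V] :
    s ^ 2 * ((finrank 𝕂 T.range : ℝ) - finrank 𝕂 V) ≤
      ∑ j with T (e j) ∉ V, ‖T (e j)‖ ^ 2 := by
  set W : Submodule 𝕂 F := Vᗮ ⊓ T.range
  have hdim : ((finrank 𝕂 T.range : ℝ) - finrank 𝕂 V) = finrank 𝕂 W := by
    rw [← Submodule.finrank_add_inf_finrank_orthogonal hV]; push_cast; ring
  set b := stdOrthonormalBasis 𝕂 W
  have hb : Orthonormal 𝕂 fun l => (b l : F) := b.orthonormal.comp_linearIsometry W.subtypeₗᵢ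
  have hin (j l) : inner 𝕂 (b l : F) (T (e j)) = inner 𝕂 (T.adjoint (b l : F)) (e j) :=
    (T.adjoint_inner_left _ _).symm
  calc s ^ 2 * ((finrank 𝕂 T.range : ℝ) - finrank 𝕂 V)
      = ∑ l, (s * ‖(b l : F)‖) ^ 2 := by
        rw [hdim]; simp [hb.1, mul_comm]
    _ ≤ ∑ l, ‖T.adjoint (b l : F)‖ ^ 2 := by
        gcongr with l
        exact h _ (b l).2.2
    _ = ∑ j, ∑ l, ‖inner 𝕂 (b l : F) (T (e j))‖ ^ 2 := by
        rw [Finset.sum_comm]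
        simp only [hin, e.sum_sq_norm_inner_left]
    _ = ∑ j with T (e j) ∉ V, ∑ l, ‖inner 𝕂 (b l : F) (T (e j))‖ ^ 2 := by
        rw [Finset.sum_filter]
        refine Finset.sum_congr rfl fun j _ => ?_
        split_ifs with hj
        · refine Finset.sum_eq_zero fun l _ => ?_
          rw [Submodule.inner_left_of_mem_orthogonal hj (b l).2.1]; simp
        · rfl
    _ ≤ _ := by
        gcongr with j
        exact hb.sum_inner_products_le _

end SingularValues

/-! ### Spanning a subspace by independent samples -/

section Sampling

open Module

variable {K E ι : Type*} [DivisionRing K] [AddCommGroup E] [Module K E] [FiniteDimensional K E]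
  [Fintype ι]

/-- The expected codimension of the span of `d` independent samples decays geometrically. -/
theorem sum_prod_mul_codim_le {a : ι → E} {w : ι → ℝ} (hw : ∀ i, 0 ≤ w i) (hw1 : ∑ i, w i = 1)
    {W : Submodule K E} (ha : ∀ i, a i ∈ W) {p : ℝ} (hp : p ≤ 1)
    [∀ V : Submodule K E, DecidablePred fun j => a j ∉ V]
    (h : ∀ V ≤ W, p * ((finrank K W : ℝ) - finrank K V) ≤ ∑ j with a j ∉ V, w j)
    (d : ℕ) (V : Submodule K E) (hV : V ≤ W) :
    ∑ I : Fin d → ι, (∏ t, w (I t)) *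
        ((finrank K W : ℝ) - finrank K ↥(V ⊔ Submodule.span K (Set.range fun t => a (I t)))) ≤
      (1 - p) ^ d * ((finrank K W : ℝ) - finrank K V) := by
  -- The starting space must vary: after conditioning on the first draw `i`, the remaining draws
  -- start from `V ⊔ span {a i}`.
  induction d generalizing V with
  | zero =>
    have (I : Fin 0 → ι) : V ⊔ Submodule.span K (Set.range fun t => a (I t)) = V := by simp
    rw [Fintype.sum_unique, this]
    simp
  | succ d ih =>
    have hVi (i) : V ⊔ Submodule.span K {a i} ≤ W :=
      sup_le hV ((Submodule.span_singleton_le_iff_mem _ _).2 (ha i))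
    have hstep (i) : w i * ((finrank K W : ℝ) - finrank K ↥(V ⊔ Submodule.span K {a i})) ≤
        w i * ((finrank K W : ℝ) - finrank K V) - if a i ∉ V then w i else 0 := by
      by_cases hi : a i ∈ V
      · have : finrank K V ≤ finrank K ↥(V ⊔ Submodule.span K {a i}) :=
          Submodule.finrank_mono le_sup_left
        rw [if_neg (not_not.2 hi), sub_zero]
        gcongr
        exact hw i
      · rw [if_pos hi]
        have : finrank K V + 1 ≤ finrank K ↥(V ⊔ Submodule.span K {a i}) :=
          Submodule.finrank_lt_finrank_of_lt
            (lt_of_le_of_ne le_sup_left fun he => hi (he ▸ Submodule.mem_sup_right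
              (Submodule.mem_span_singleton_self _)))
        have : (finrank K V : ℝ) + 1 ≤ finrank K ↥(V ⊔ Submodule.span K {a i}) := by
          exact_mod_cast this
        nlinarith [hw i]
    rw [← (Fin.consEquiv fun _ => ι).sum_comp, Fintype.sum_prod_type]
    calc _ = ∑ i, w i * ∑ I : Fin d → ι, (∏ t, w (I t)) * ((finrank K W : ℝ) -
          finrank K ↥((V ⊔ Submodule.span K {a i}) ⊔
            Submodule.span K (Set.range fun t => a (I t)))) := by
          refine Finset.sum_congr rfl fun i _ => ?_
          rw [Finset.mul_sum]
          refine Finset.sum_congr rfl fun I _ => ?_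
          have : (Set.range fun t => a (Fin.consEquiv (fun _ => ι) (i, I) t)) =
              {a i} ∪ Set.range fun t => a (I t) := by
            ext y
            simp [Fin.exists_fin_succ, eq_comm]
          rw [this, Submodule.span_union, sup_assoc]
          simp only [Fin.consEquiv_apply, Fin.prod_univ_succ, Fin.cons_zero, Fin.cons_succ,
            mul_assoc]
      _ ≤ ∑ i, w i * ((1 - p) ^ d *
            ((finrank K W : ℝ) - finrank K ↥(V ⊔ Submodule.span K {a i}))) := by
          gcongr with i
          · exact hw i
          · exact ih _ (hVi i)
      _ = (1 - p) ^ d * ∑ i, w i *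
            ((finrank K W : ℝ) - finrank K ↥(V ⊔ Submodule.span K {a i})) := by
          rw [Finset.mul_sum]
          exact Finset.sum_congr rfl fun i _ => by ring
      _ ≤ (1 - p) ^ d * ∑ i, (w i * ((finrank K W : ℝ) - finrank K V) -
            if a i ∉ V then w i else 0) := by
          have : 0 ≤ 1 - p := by linarith
          gcongr with i
          exact hstep i
      _ ≤ (1 - p) ^ d * ((1 - p) * ((finrank K W : ℝ) - finrank K V)) := by
          have : 0 ≤ 1 - p := by linarith
          gcongr
          rw [Finset.sum_sub_distrib, ← Finset.sum_mul, hw1, ← Finset.sum_filter]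
          linarith [h V hV]
      _ = _ := by ring

/-- Markov's inequality: the codimension is a nonnegative integer, hence at least one whenever the
samples fail to span. -/
theorem sum_prod_span_lt_le {a : ι → E} {w : ι → ℝ} (hw : ∀ i, 0 ≤ w i) (hw1 : ∑ i, w i = 1)
    {W : Submodule K E} (ha : ∀ i, a i ∈ W) {p : ℝ} (hp : p ≤ 1)
    [∀ V : Submodule K E, DecidablePred fun j => a j ∉ V]
    (h : ∀ V ≤ W, p * ((finrank K W : ℝ) - finrank K V) ≤ ∑ j with a j ∉ V, w j) (d : ℕ) :
    ∑ I : Fin d → ι with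
        finrank K ↥(Submodule.span K (Set.range fun t => a (I t))) ≠ finrank K W,
      ∏ t, w (I t) ≤ (1 - p) ^ d * finrank K W := by
  have := sum_prod_mul_codim_le hw hw1 ha hp h d ⊥ bot_le
  rw [finrank_bot, Nat.cast_zero, sub_zero] at this
  refine le_trans ?_ this
  rw [Finset.sum_filter]
  refine Finset.sum_le_sum fun I _ => ?_
  rw [bot_sup_eq]
  have hle : finrank K ↥(Submodule.span K (Set.range fun t => a (I t))) ≤ finrank K W :=
    Submodule.finrank_mono (Submodule.span_le.2 (by rintro _ ⟨t, rfl⟩; exact ha _))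
  have hpos : 0 ≤ ∏ t, w (I t) := Finset.prod_nonneg fun t _ => hw _
  split_ifs with hI
  · have : (finrank K ↥(Submodule.span K (Set.range fun t => a (I t))) : ℝ) + 1 ≤ finrank K W := by
      exact_mod_cast lt_of_le_of_ne hle hI
    nlinarith
  · have : (finrank K ↥(Submodule.span K (Set.range fun t => a (I t))) : ℝ) ≤ finrank K W := by
      exact_mod_cast hle
    exact mul_nonneg hpos (by linarith)

/-- Sampling a point distribution `d` times, the samples span `W` except with small probability. -/
theorem pi_toMeasure_real_span_ge [MeasurableSpace ι] [MeasurableSingletonClass ι]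
    (q : PMF ι) {a : ι → E} {W : Submodule K E} (ha : ∀ i, a i ∈ W) {p : ℝ} (hp : p ≤ 1)
    [∀ V : Submodule K E, DecidablePred fun j => a j ∉ V]
    (h : ∀ V ≤ W, p * ((finrank K W : ℝ) - finrank K V) ≤ ∑ j with a j ∉ V, (q j).toReal)
    (d : ℕ) :
    1 - (1 - p) ^ d * finrank K W ≤
      (MeasureTheory.Measure.pi fun _ : Fin d => q.toMeasure).real
        {I | finrank K ↥(Submodule.span K (Set.range fun t => a (I t))) = finrank K W} := by
  classical
  have hq1 : ∑ i, (q i).toReal = 1 := by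
    rw [← ENNReal.toReal_sum fun i _ => q.apply_ne_top i, ← tsum_fintype (L := .unconditional ι), q.tsum_coe]
    rfl
  have hb := sum_prod_span_lt_le (w := fun i => (q i).toReal) (fun _ => ENNReal.toReal_nonneg) hq1 ha hp h d
  set μ := MeasureTheory.Measure.pi fun _ : Fin d => q.toMeasure
  have hμ (I : Fin d → ι) : μ.real {I} = ∏ t, (q (I t)).toReal := by
    rw [MeasureTheory.measureReal_def, MeasureTheory.Measure.pi_singleton, ENNReal.toReal_prod]
    simp
  set S := {I : Fin d → ι |
    finrank K ↥(Submodule.span K (Set.range fun t => a (I t))) = finrank K W} with hS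
  have hc : μ.real Sᶜ ≤ (1 - p) ^ d * finrank K W := by
    refine le_trans (le_of_eq ?_) hb
    simp only [← hμ]
    rw [MeasureTheory.sum_measureReal_singleton]
    congr 1
    ext I
    simp [hS]
  rw [MeasureTheory.probReal_compl_eq_one_sub (Set.toFinite S).measurableSet] at hc
  linarith

end Sampling

/-! ### Deterministic exactness of the CUR decomposition -/

section CUR

variable {𝕂 : Type*} [RCLike 𝕂] {m n α β : Type*} [Fintype α] [Fintype β]

theorem exists_eq_submatrix_mul [Fintype n] {A : Matrix m n 𝕂} {J : β → n}
    (h : (A.submatrix id J).rank = A.rank) : ∃ X : Matrix β n 𝕂, A = A.submatrix id J * X := by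
  classical
  have hle : (A.submatrix id J).mulVecLin.range ≤ A.mulVecLin.range := by
    rw [Matrix.range_mulVecLin, Matrix.range_mulVecLin]
    refine Submodule.span_mono ?_
    rintro _ ⟨j, rfl⟩
    exact ⟨J j, rfl⟩
  have heq := Submodule.eq_of_le_of_finrank_eq hle h
  have hcol (j : n) : ∃ x : β → 𝕂, (A.submatrix id J).mulVec x = A.col j := by
    have : A.col j ∈ (A.submatrix id J).mulVecLin.range := by
      rw [heq, Matrix.range_mulVecLin]
      exact Submodule.subset_span ⟨j, rfl⟩
    exact this
  choose x hx using hcol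
  refine ⟨Matrix.of fun b j => x j b, ?_⟩
  ext i j
  exact (congrFun (hx j) i).symm

theorem exists_eq_mul_submatrix [Fintype m] [Fintype n] {A : Matrix m n 𝕂} {I : α → m}
    (h : (A.submatrix I id).rank = A.rank) : ∃ Y : Matrix m α 𝕂, A = Y * A.submatrix I id := by
  obtain ⟨X, hX⟩ := exists_eq_submatrix_mul (A := Aᵀ) (J := I) (by
    rw [← Matrix.transpose_submatrix, Matrix.rank_transpose, Matrix.rank_transpose, h])
  refine ⟨Xᵀ, ?_⟩
  have := congrArg Matrix.transpose hX
  rwa [Matrix.transpose_mul, Matrix.transpose_transpose, ← Matrix.transpose_submatrix,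
    Matrix.transpose_transpose] at this

/-- If the chosen rows and columns have full rank, the CUR decomposition is exact. -/
theorem rank_eq_and_eq_cur [Fintype m] [Fintype n] {A : Matrix m n 𝕂} {I : α → m} {J : β → n}
    (hI : (A.submatrix I id).rank = A.rank) (hJ : (A.submatrix id J).rank = A.rank) :
    (A.submatrix I J).rank = A.rank ∧
      A = A.submatrix id J * pinv (A.submatrix I J) * A.submatrix I id := by
  classical
  obtain ⟨X, hX⟩ := exists_eq_submatrix_mul hJ
  obtain ⟨Y, hY⟩ := exists_eq_mul_submatrix hI
  have hC : A.submatrix id J = Y * A.submatrix I J := by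
    conv_lhs => rw [hY]
    rfl
  have hR : A.submatrix I id = A.submatrix I J * X := by
    conv_lhs => rw [hX]
    rfl
  -- With `C = Y U`, `R = U X` and `A = Y U X`, the single Penrose equation `U U† U = U` suffices.
  have hA : A = Y * A.submatrix I J * X := by rw [← hC]; exact hX
  constructor
  · refine le_antisymm (Matrix.rank_submatrix_le _ _ _) ?_
    conv_lhs => rw [hA]
    exact (Matrix.rank_mul_le_left _ _).trans (Matrix.rank_mul_le_right _ _)
  · rw [hC, hR]
    have := (isMoorePenrose_pinv (A.submatrix I J)).mul_mul_self
    calc A = Y * A.submatrix I J * X := hA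
      _ = Y * (A.submatrix I J * pinv (A.submatrix I J) * A.submatrix I J) * X := by rw [this]
      _ = _ := by simp only [Matrix.mul_assoc]

/-- The column span ignores repetitions, which transfers the result to the sets of distinct indices.
-/
theorem rank_submatrix_cols_eq_of_range_eq {A : Matrix m n 𝕂} {J : α → n} {J' : β → n}
    (h : Set.range J = Set.range J') :
    (A.submatrix id J).rank = (A.submatrix id J').rank := by
  have key : Set.range (A.submatrix id J).col = Set.range (A.submatrix id J').col := by
    calc _ = A.col '' Set.range J := by rw [← Set.range_comp]; rfl
      _ = _ := by rw [h, ← Set.range_comp]; rfl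
  rw [Matrix.rank_eq_finrank_span_cols, Matrix.rank_eq_finrank_span_cols, key]

theorem rank_submatrix_rows_eq_of_range_eq [Fintype n] {A : Matrix m n 𝕂} {I : α → m} {I' : β → m}
    (h : Set.range I = Set.range I') :
    (A.submatrix I id).rank = (A.submatrix I' id).rank := by
  rw [← Matrix.rank_transpose, ← Matrix.rank_transpose (A.submatrix I' id)]
  exact rank_submatrix_cols_eq_of_range_eq (A := Aᵀ) h

theorem range_dedup {d p : ℕ} (I : Fin d → Fin p) : Set.range (dedup I) = Set.range I := by
  ext x
  simp [dedup]

end CUR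

end CURSampling
namespace CURSampling

open scoped Matrix ComplexOrder

/-! ### Probability that the sampled rows and columns have full rank -/

section RankProbability

open Module

variable {𝕂 : Type*} [RCLike 𝕂] {m n : ℕ}

theorem toEuclideanLin_basisFun (A : Matrix (Fin m) (Fin n) 𝕂) (j : Fin n) :
    Matrix.toEuclideanLin A (EuclideanSpace.basisFun (Fin n) 𝕂 j) =
      WithLp.toLp 2 fun i => A i j := by
  ext i
  simp [Matrix.toLpLin_apply]

theorem rank_submatrix_cols_eq_finrank_span {β : Type*} [Fintype β] (A : Matrix (Fin m) (Fin n) 𝕂)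
    (J : β → Fin n) :
    (A.submatrix id J).rank = finrank 𝕂 ↥(Submodule.span 𝕂 (Set.range fun t =>
      Matrix.toEuclideanLin A (EuclideanSpace.basisFun (Fin n) 𝕂 (J t)))) := by
  have : (fun t => Matrix.toEuclideanLin A (EuclideanSpace.basisFun (Fin n) 𝕂 (J t))) =
      (WithLp.linearEquiv 2 𝕂 (Fin m → 𝕂)).symm ∘ (A.submatrix id J).col :=
    funext fun t => toEuclideanLin_basisFun A (J t)
  rw [Matrix.rank_eq_finrank_span_cols,
    ← LinearEquiv.finrank_map_eq (WithLp.linearEquiv 2 𝕂 (Fin m → 𝕂)).symm, Submodule.map_span,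
    this, Set.range_comp]
  rfl

theorem span_range_toEuclideanLin_basisFun (A : Matrix (Fin m) (Fin n) 𝕂) :
    Submodule.span 𝕂 (Set.range fun j =>
      Matrix.toEuclideanLin A (EuclideanSpace.basisFun (Fin n) 𝕂 j)) =
      (Matrix.toEuclideanLin A).range := by
  rw [LinearMap.range_eq_map, ← (EuclideanSpace.basisFun (Fin n) 𝕂).toBasis.span_eq,
    Submodule.map_span, ← Set.range_comp]
  simp only [OrthonormalBasis.coe_toBasis]
  rfl

theorem rank_eq_finrank_range_toEuclideanLin (A : Matrix (Fin m) (Fin n) 𝕂) :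
    A.rank = finrank 𝕂 (Matrix.toEuclideanLin A).range := by
  rw [← span_range_toEuclideanLin_basisFun]
  exact rank_submatrix_cols_eq_finrank_span A id

/-- The factor 3 is spent as 1 + 2: one `log x / δ` absorbs the prefactor `x`, and the other two
give `1 / δ` because `log x ≥ 1 / 2`. -/
theorem mul_exp_neg_le_exp_neg {x y δ : ℝ} (hx : 2 ≤ x) (hδ : δ ∈ Set.Ioo (0 : ℝ) 1)
    (hy : 3 * (Real.log x / δ) ≤ y) : x * Real.exp (-y) ≤ Real.exp (-1 / δ) := by
  have hδ0 := hδ.1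
  have hl : 1 / 2 ≤ Real.log x :=
    (by linarith [Real.log_two_gt_d9] : (1 / 2 : ℝ) ≤ Real.log 2).trans
      (Real.log_le_log two_pos hx)
  have h1 : Real.log x ≤ Real.log x / δ := le_div_self (by linarith) hδ0 hδ.2.le
  have h2 : 1 / 2 / δ ≤ Real.log x / δ := by gcongr
  calc x * Real.exp (-y) = Real.exp (Real.log x - y) := by
        rw [sub_eq_add_neg, Real.exp_add, Real.exp_log (by linarith)]
    _ ≤ _ := by
        gcongr
        have : -1 / δ = -2 * (1 / 2 / δ) := by ring
        linarith

/-- Length-squared sampling of columns captures the whole column space with high probability. -/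
theorem one_sub_le_measure_rank_cols {A : Matrix (Fin m) (Fin n) 𝕂} (hA : A ≠ 0)
    {q : PMF (Fin n)} (hq : ∀ j, (q j).toReal = colLength A j ^ 2 / frobNorm A ^ 2)
    {s : ℝ} (hs : 0 ≤ s) (h : ∀ u ∈ (Matrix.toEuclideanLin A).range,
      s * ‖u‖ ≤ ‖(Matrix.toEuclideanLin A).adjoint u‖)
    {δ x : ℝ} (hδ : δ ∈ Set.Ioo (0 : ℝ) 1) (hx0 : 0 ≤ x) (hx : frobNorm A ^ 2 ≤ δ * x * s ^ 2)
    {d : ℕ} (hd : 1 ≤ d) (hdx : 3 * (x * Real.log x) ≤ d) :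
    1 - 2 * Real.exp (-1 / δ) ≤ (MeasureTheory.Measure.pi fun _ : Fin d => q.toMeasure).real
      {J | (A.submatrix id J).rank = A.rank} := by
  classical
  set T := Matrix.toEuclideanLin A with hT
  set e := EuclideanSpace.basisFun (Fin n) 𝕂
  set k := finrank 𝕂 T.range with hk
  have hF := frobNorm_sq_pos hA
  have hrange (j) : T (e j) ∈ T.range := ⟨_, rfl⟩
  have hlen (j) : ‖T (e j)‖ = colLength A j := by
    rw [toEuclideanLin_basisFun]; rfl
  have hset : {J : Fin d → Fin n | (A.submatrix id J).rank = A.rank} =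
      {J | finrank 𝕂 ↥(Submodule.span 𝕂 (Set.range fun t => T (e (J t)))) = finrank 𝕂 T.range} := by
    ext J
    rw [Set.mem_ofPred_eq, rank_submatrix_cols_eq_finrank_span, rank_eq_finrank_range_toEuclideanLin]
    rfl
  rw [hset]
  have hk0 : k ≠ 0 := by
    rw [hk, Ne, Submodule.finrank_eq_zero, LinearMap.range_eq_bot, hT]
    simpa using hA
  have hexp := Real.exp_pos (-1 / δ)
  have hq1 : ∑ j, (q j).toReal = 1 := by
    simp only [hq]
    rw [← Finset.sum_div, sum_colLength_sq, div_self hF.ne']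
  rcases Nat.lt_or_ge k 2 with hk2 | hk2
  -- Here `x ≥ 2` may fail, but any nonzero column spans the range and zero columns have probability
  -- zero, so `p = 1` is admissible and `d ≥ 1` draws suffice.
  · have hk1 : k = 1 := by omega
    refine le_trans ?_ (pi_toMeasure_real_span_ge (K := 𝕂) q hrange le_rfl (fun V hV => ?_) d)
    · rw [sub_self, zero_pow (by omega)]
      linarith
    · rw [← hk, hk1, one_mul, Nat.cast_one]
      rcases Nat.eq_zero_or_pos (finrank 𝕂 V) with h0 | h0
      · rw [h0, Nat.cast_zero, sub_zero, ← hq1, Finset.sum_filter]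
        refine Finset.sum_le_sum fun j _ => ?_
        split_ifs with hj
        · rw [Submodule.finrank_eq_zero.1 h0, Submodule.mem_bot] at hj
          rw [hq, ← hlen, hj]; simp
        · exact le_rfl
      · have : (1 : ℝ) ≤ finrank 𝕂 V := by exact_mod_cast h0
        exact le_trans (by linarith) (Finset.sum_nonneg fun _ _ => ENNReal.toReal_nonneg)
  · set p := s ^ 2 / frobNorm A ^ 2 with hp
    have hcov : ∀ V ≤ T.range, p * ((finrank 𝕂 T.range : ℝ) - finrank 𝕂 V) ≤
        ∑ j with T (e j) ∉ V, (q j).toReal := by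
      intro V hV
      simp only [hq, ← hlen]
      rw [← Finset.sum_div, hp, div_mul_eq_mul_div]
      gcongr
      exact singularValues_sq_mul_codim_le_sum e T hs h hV
    -- The covering bound at `V = ⊥` compares `p * k` with the total probability.
    have hkp : p * k ≤ 1 := by
      have := hcov ⊥ bot_le
      rw [finrank_bot, Nat.cast_zero, sub_zero] at this
      refine this.trans (le_trans ?_ hq1.le)
      exact Finset.sum_le_sum_of_subset_of_nonneg (Finset.filter_subset _ _)
        fun _ _ _ => ENNReal.toReal_nonneg
    have hp0 : 0 ≤ p := by positivity
    have hk2' : (2 : ℝ) ≤ k := by exact_mod_cast hk2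
    have hp1 : p ≤ 1 := by nlinarith
    have hxp : 1 ≤ δ * (x * p) := by
      rw [hp, ← mul_div_assoc, ← mul_div_assoc, ← mul_assoc]
      exact (one_le_div hF).2 hx
    have hxp1 : 1 ≤ x * p := by nlinarith [hδ.1, hδ.2, mul_nonneg hx0 hp0]
    have hkx : (k : ℝ) ≤ x := by nlinarith
    have hx2 : 2 ≤ x := hk2'.trans hkx
    have hdp : 3 * (Real.log x / δ) ≤ p * d := by
      have hlog : 0 ≤ Real.log x := Real.log_nonneg (by linarith)
      calc 3 * (Real.log x / δ) = 3 * (Real.log x * 1 / δ) := by ring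
        _ ≤ 3 * (Real.log x * (δ * (x * p)) / δ) := by
            have := hδ.1
            gcongr
        _ = p * (3 * (x * Real.log x)) := by
            field_simp [hδ.1.ne']
        _ ≤ p * d := by gcongr
    refine le_trans ?_ (pi_toMeasure_real_span_ge (K := 𝕂) q hrange hp1 hcov d)
    have h1 : (1 - p) ^ d ≤ Real.exp (-(p * d)) := by
      calc (1 - p) ^ d ≤ Real.exp (-p) ^ d := by
            have := Real.one_sub_le_exp_neg p
            gcongr
        _ = _ := by rw [← Real.exp_nat_mul]; congr 1; ring
    have h2 : (1 - p) ^ d * k ≤ x * Real.exp (-(p * d)) := by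
      rw [mul_comm]
      have : 0 ≤ 1 - p := by linarith
      gcongr
    have h3 := mul_exp_neg_le_exp_neg hx2 hδ hdp
    rw [← hk]
    linarith

theorem specNorm_le_singularValues_zero (A : Matrix (Fin m) (Fin n) 𝕂) :
    specNorm A ≤ (Matrix.toEuclideanLin A).singularValues 0 :=
  ContinuousLinearMap.opNorm_le_bound _ (LinearMap.singularValues_nonneg _ 0)
    (norm_map_le_singularValues_zero _)

theorem specNorm_pos {A : Matrix (Fin m) (Fin n) 𝕂} (hA : A ≠ 0) : 0 < specNorm A := by
  rw [specNorm, norm_pos_iff]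
  simpa using hA

theorem toReal_colPMF {A : Matrix (Fin m) (Fin n) 𝕂} (hA : A ≠ 0) (j : Fin n) :
    (colPMF A hA j).toReal = colLength A j ^ 2 / frobNorm A ^ 2 := by
  rw [colPMF, PMF.ofFintype_apply, ENNReal.toReal_ofReal (by positivity)]

theorem colLength_conjTranspose (A : Matrix (Fin m) (Fin n) 𝕂) (i : Fin m) :
    colLength Aᴴ i = rowLength A i := by
  simp [colLength, rowLength, EuclideanSpace.norm_eq]

theorem frobNorm_conjTranspose (A : Matrix (Fin m) (Fin n) 𝕂) : frobNorm Aᴴ = frobNorm A := by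
  rw [frobNorm, frobNorm, Finset.sum_comm]
  simp

theorem toReal_rowPMF {A : Matrix (Fin m) (Fin n) 𝕂} (hA : A ≠ 0) (i : Fin m) :
    (rowPMF A hA i).toReal = colLength Aᴴ i ^ 2 / frobNorm Aᴴ ^ 2 := by
  rw [rowPMF, PMF.ofFintype_apply, ENNReal.toReal_ofReal (by positivity),
    colLength_conjTranspose, frobNorm_conjTranspose]

theorem frobNorm_sq_le {A : Matrix (Fin m) (Fin n) 𝕂} (hA : A ≠ 0) {δ ε : ℝ}
    (hδ : δ ∈ Set.Ioo (0 : ℝ) 1) (hε : 0 < ε) (hεA : ε < (condNumber A)⁻¹) :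
    frobNorm A ^ 2 ≤ δ * (stableRank A / (ε ^ 4 * δ)) *
      (Matrix.toEuclideanLin A).singularValues (A.rank - 1) ^ 2 := by
  set T := Matrix.toEuclideanLin A with hT
  set s := T.singularValues (A.rank - 1)
  have hσ : 0 < T.singularValues 0 := (specNorm_pos hA).trans_le (specNorm_le_singularValues_zero A)
  have h1 : ε * T.singularValues 0 < s := by
    rwa [condNumber, inv_div, lt_div_iff₀ hσ] at hεA
  have h2 : s ≤ T.singularValues 0 := T.singularValues_antitone (Nat.zero_le _)
  have hε1 : ε ≤ 1 := by
    by_contra! hc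
    nlinarith
  have hsp := specNorm_pos hA
  -- Only `ε ^ 2` is needed; the fourth power is weakened to it using `ε ≤ 1`.
  have h3 : ε ^ 4 * specNorm A ^ 2 ≤ s ^ 2 :=
    calc ε ^ 4 * specNorm A ^ 2 ≤ ε ^ 2 * T.singularValues 0 ^ 2 := by
          gcongr ?_ * ?_ ^ 2
          · exact pow_le_pow_of_le_one hε.le hε1 (by norm_num)
          · exact specNorm_le_singularValues_zero A
      _ = (ε * T.singularValues 0) ^ 2 := by ring
      _ ≤ s ^ 2 := by gcongr
  have hδ0 := hδ.1
  have : δ * (stableRank A / (ε ^ 4 * δ)) * s ^ 2 =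
      frobNorm A ^ 2 * (s ^ 2 / (ε ^ 4 * specNorm A ^ 2)) := by
    rw [stableRank]
    field_simp
  rw [this]
  exact le_mul_of_one_le_right (sq_nonneg _) ((one_le_div (by positivity)).2 h3)

theorem sq_le_samplingLaw_real {A : Matrix (Fin m) (Fin n) 𝕂} (hA : A ≠ 0) {δ ε : ℝ}
    (hδ : δ ∈ Set.Ioo (0 : ℝ) 1) (hε : 0 < ε) (hεA : ε < (condNumber A)⁻¹)
    {d₁ d₂ : ℕ} (hd₁ : 1 ≤ d₁) (hd₂ : 1 ≤ d₂)
    (h₁ : 3 * ((stableRank A / (ε ^ 4 * δ)) * Real.log (stableRank A / (ε ^ 4 * δ))) ≤ d₁)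
    (h₂ : 3 * ((stableRank A / (ε ^ 4 * δ)) * Real.log (stableRank A / (ε ^ 4 * δ))) ≤ d₂) :
    (1 - 2 * Real.exp (-1 / δ)) ^ 2 ≤ (samplingLaw A hA d₁ d₂).real
      ({I | (A.submatrix I id).rank = A.rank} ×ˢ {J | (A.submatrix id J).rank = A.rank}) := by
  have hF := frobNorm_sq_le hA hδ hε hεA
  have hs := (Matrix.toEuclideanLin A).singularValues_nonneg (A.rank - 1)
  have hx : 0 ≤ stableRank A / (ε ^ 4 * δ) := by
    have := hδ.1
    rw [stableRank]; positivity
  have hJ := one_sub_le_measure_rank_cols hA (toReal_colPMF hA) hs (fun u hu => by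
    rw [rank_eq_finrank_range_toEuclideanLin]
    exact singularValues_mul_norm_le_norm_adjoint _ hu) hδ hx hF hd₂ h₂
  -- Rows of `A` are conjugated columns of `Aᴴ`. The range of `Aᴴ` is the orthogonal complement of
  -- the kernel of `A`, so the same singular value of `A` serves and those of `Aᴴ` never enter.
  have hI := one_sub_le_measure_rank_cols (A := Aᴴ) (by simpa using hA) (toReal_rowPMF hA) hs
    (fun u hu => by
      rw [rank_eq_finrank_range_toEuclideanLin, ← Matrix.toEuclideanLin_conjTranspose_eq_adjoint,
        Matrix.conjTranspose_conjTranspose]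
      refine singularValues_mul_norm_le _ ?_
      rwa [LinearMap.orthogonal_ker, ← Matrix.toEuclideanLin_conjTranspose_eq_adjoint]) hδ hx
    (by rwa [frobNorm_conjTranspose]) hd₁ h₁
  have hset : {I : Fin d₁ → Fin m | (Aᴴ.submatrix id I).rank = Aᴴ.rank} =
      {I | (A.submatrix I id).rank = A.rank} := by
    ext I
    rw [Set.mem_ofPred_eq, ← Matrix.conjTranspose_submatrix, Matrix.rank_conjTranspose,
      Matrix.rank_conjTranspose]
    rfl
  rw [hset] at hI
  rw [samplingLaw, MeasureTheory.measureReal_prod_prod, sq]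
  -- Multiplying the two lower bounds requires this sign; it holds because `exp (-1) < 1 / 2`.
  have h0 : 0 ≤ 1 - 2 * Real.exp (-1 / δ) := by
    have h1 : Real.exp (-1 / δ) ≤ Real.exp (-1) := by
      gcongr
      rw [div_le_iff₀ hδ.1]
      linarith [hδ.2]
    have := Real.exp_neg_one_lt_d9
    linarith
  gcongr

end RankProbability

end CURSampling

theorem mainTheorem2 :
    ∃ C > (0 : ℝ), ∃ c > (0 : ℝ),
      ∀ (𝕂 : Type) [RCLike 𝕂] (m n : ℕ) (A : Matrix (Fin m) (Fin n) 𝕂) (hA : A ≠ 0)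
        (k : ℕ) (r : ℝ), A.rank = k → CURSampling.stableRank A = r →
      ∀ δ ∈ Set.Ioo (0 : ℝ) 1, ∀ ε : ℝ, 0 < ε → ε < (CURSampling.condNumber A)⁻¹ →
      ∀ d₁ ∈ Finset.Icc 1 m, ∀ d₂ ∈ Finset.Icc 1 n,
        C * ((r / (ε ^ 4 * δ)) * Real.log (r / (ε ^ 4 * δ))) ≤ (d₁ : ℝ) →
        C * ((r / (ε ^ 4 * δ)) * Real.log (r / (ε ^ 4 * δ))) ≤ (d₂ : ℝ) →
        (1 - 2 * Real.exp (-c / δ)) ^ 2 ≤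
            (CURSampling.samplingLaw A hA d₁ d₂).real
              {ω | (A.submatrix ω.1 ω.2).rank = k ∧
                A = A.submatrix id ω.2 * CURSampling.pinv (A.submatrix ω.1 ω.2) *
                  A.submatrix ω.1 id} ∧
        (1 - 2 * Real.exp (-c / δ)) ^ 2 ≤
            (CURSampling.samplingLaw A hA d₁ d₂).real
              {ω | (A.submatrix (CURSampling.dedup ω.1) (CURSampling.dedup ω.2)).rank = k ∧
                A = A.submatrix id (CURSampling.dedup ω.2) *
                    CURSampling.pinv
                      (A.submatrix (CURSampling.dedup ω.1) (CURSampling.dedup ω.2)) *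
                  A.submatrix (CURSampling.dedup ω.1) id} := by
  refine ⟨3, by norm_num, 1, one_pos, ?_⟩
  rintro 𝕂 _ m n A hA k r rfl rfl δ hδ ε hε hεA d₁ hd₁ d₂ hd₂ h₁ h₂
  have h := CURSampling.sq_le_samplingLaw_real hA hδ hε hεA (Finset.mem_Icc.1 hd₁).1
    (Finset.mem_Icc.1 hd₂).1 h₁ h₂
  have : MeasureTheory.IsProbabilityMeasure (CURSampling.samplingLaw A hA d₁ d₂) := by
    unfold CURSampling.samplingLaw
    infer_instance
  refine ⟨h.trans (MeasureTheory.measureReal_mono ?_), h.trans (MeasureTheory.measureReal_mono ?_)⟩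
  · rintro ⟨I, J⟩ ⟨hI, hJ⟩
    exact CURSampling.rank_eq_and_eq_cur hI hJ
  · rintro ⟨I, J⟩ ⟨hI, hJ⟩
    exact CURSampling.rank_eq_and_eq_cur
      ((CURSampling.rank_submatrix_rows_eq_of_range_eq (CURSampling.range_dedup I)).trans hI)
      ((CURSampling.rank_submatrix_cols_eq_of_range_eq (CURSampling.range_dedup J)).trans hJ)
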